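/- Let $A:\mathbb R^n\to\mathbb R^m$ be linear, $c\in\mathbb R^n$, and let $\Phi$ be a $\vartheta$-self-concordant barrier ($\vartheta>0$) whose domain is an open convex set $U\subset\mathbb R^m$; that is, $\Phi$ is convex and $C^3$ on $U$, tends to $+\infty$ at the boundary of $U$, and for all $x\in U$, $h\in\mathbb R^m$, $$|D^3\Phi(x)[h,h,h]|\le 2\,(D^2\Phi(x)[h,h])^{3/2},\qquad (D\Phi(x)[h])^2\le\vartheta\, D^2\Phi(x)[h,h].$$ Put $D=\overline U$, let $\mathrm{rec}(D)$ be its recession cone, $D_*=\{y:\langle y,h\rangle\le 0\ \ \forall h\in \mathrm{rec}(D)\}$, and let $\Phi_*(y)=\sup_{z\in U}\big(\langle y,z\rangle-\Phi(z)\big)$ be the Legendre–Fenchel conjugate, with gradient $\Phi_*'$ and Hessian $\Phi_*''$ on $\operatorname{int}D_*$. Fix $z^0\in\operatorname{int}D$ and real numbers $\xi>1$ and $\kappa$ with $\xi-1-\kappa>0$, and set $y^0=\Phi'(z^0)$ and $y_{\tau,0}=-\langle y^0,z^0\rangle-\xi\vartheta$. Let $$Q_{DD}=\Big\{(x,\tau,y):\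 Ax+\tfrac1\tau z^0\in\operatorname{int}D,\ \tau>0,\ A^\top y-A^\top y^0=-(\tau-1)c,\ y\in\operatorname{int}D_*\Big\},$$ $$\mu(x,\tau,y)=\frac{\tau}{\xi\vartheta}\Big[-y_{\tau,0}-\tau\langle c,x\rangle-\big\langle y,Ax+\tfrac1\tau z^0\big\rangle\Big].$$ A point $(x,\tau,y)\in Q_{DD}$ is called $\kappa$-close to the central path if $\mu:=\mu(x,\tau,y)>0$ and $$\Big\|Ax+\tfrac1\tau z^0-\Phi_*'\big(\tfrac{\tau}{\mu}y\big)\Big\|_{[\Phi_*''(\frac{\tau}{\mu}y)]^{-1}}\le\kappa,\qquad\text{where } \|u\|_{B^{-1}}=\langle u,B^{-1}u\rangle^{1/2}.$$ (a) If $(x,\tau,y)$ and $(\bar x,\bar\tau,\bar y)$ in $Q_{DD}$ are both $\kappa$-close to the central path, with $\mu=\mu(x,\tau,y)$ and $\bar\mu=\mu(\bar x,\bar\tau,\bar y)$, then $$\mu\bar\tau^2+\bar\mu\tau^2\ \le\ \frac{\xi}{\xi-1-\kappa}\,\tau\bar\tau\,(\mu+\bar\mu).$$ (b) Every point $(x,\tau,y)\in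 Q_{DD}$ that is $\kappa$-close to the central path and has $\mu(x,\tau,y)\ge 1$ satisfies $$\tau\ \ge\ \frac{\xi-1-\kappa}{2\xi}.$$ -/

import Mathlib

open Set Filter Topology
open scoped InnerProductSpace

namespace DomainDriven

section Barrier

variable {E : Type*} [NormedAddCommGroup E] [InnerProductSpace ℝ E]

/-- `Φ` is a `ϑ`-self-concordant barrier with (open convex) domain `U`; the values of `Φ` outside
`U` are irrelevant. `barrier` says that `Φ` tends to `+∞` at the boundary of its domain. -/
structure IsSelfConcordantBarrier (ϑ : ℝ) (U : Set E) (Φ : E → ℝ) : Prop where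
  pos : 0 < ϑ
  isOpen : IsOpen U
  convexOn : ConvexOn ℝ U Φ
  contDiffOn : ContDiffOn ℝ 3 Φ U
  barrier : ∀ x ∈ frontier U, Tendsto Φ (𝓝[U] x) atTop
  selfConcordant : ∀ x ∈ U, ∀ h : E,
    |iteratedFDeriv ℝ 3 Φ x (fun _ => h)| ≤
      2 * (iteratedFDeriv ℝ 2 Φ x (fun _ => h)) ^ (3 / 2 : ℝ)
  parameter : ∀ x ∈ U, ∀ h : E,
    (fderiv ℝ Φ x h) ^ 2 ≤ ϑ * iteratedFDeriv ℝ 2 Φ x (fun _ => h)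

/-- The recession cone of `D`. -/
def recessionCone (D : Set E) : Set E :=
  {h | ∀ z ∈ D, ∀ t : ℝ, 0 ≤ t → z + t • h ∈ D}

/-- The cone `D_*`, the polar of the recession cone of `D`. The dual space is identified with `E`
through the inner product. -/
def dualCone (D : Set E) : Set E :=
  {y | ∀ h ∈ recessionCone D, ⟪y, h⟫_ℝ ≤ 0}

/-- The Legendre-Fenchel conjugate `Φ_*` of a function `Φ` with domain `U`
(meaningful at the points `y` where the supremum is finite). -/
noncomputable def conjugate (U : Set E) (Φ : E → ℝ) (y : E) : ℝ :=
  ⨆ z : U, (⟪y, (z : E)⟫_ℝ - Φ z)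

/-- The Hessian of `f` at `w`, as a linear operator: the derivative of the gradient. -/
noncomputable def hessian [CompleteSpace E] (f : E → ℝ) (w : E) : E →L[ℝ] E :=
  fderiv ℝ (gradient f) w

/-- The norm `‖u‖_{B⁻¹} = ⟨u, B⁻¹ u⟩ ^ (1/2)` attached to a positive definite operator `B`. -/
noncomputable def inverseNorm (B : E →L[ℝ] E) (u : E) : ℝ :=
  Real.sqrt ⟪u, B.inverse u⟫_ℝ

end Barrier

section Path

variable {X E : Type*} [NormedAddCommGroup X] [InnerProductSpace ℝ X] [FiniteDimensional ℝ X]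
  [NormedAddCommGroup E] [InnerProductSpace ℝ E] [FiniteDimensional ℝ E]

/-- The set `Q_DD` of triples `(x, τ, y)`, where `D` is the closure of the domain `U` of `Φ`, and
`y⁰ = Φ'(z⁰)`. -/
noncomputable def QDD (A : X →ₗ[ℝ] E) (c : X) (U : Set E) (Φ : E → ℝ) (z₀ : E) :
    Set (X × ℝ × E) :=
  {p | A p.1 + (1 / p.2.1) • z₀ ∈ interior (closure U) ∧ 0 < p.2.1 ∧
    A.adjoint p.2.2 - A.adjoint (gradient Φ z₀) = -((p.2.1 - 1) • c) ∧
    p.2.2 ∈ interior (dualCone (closure U))}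

/-- The initial value `y_{τ,0} = -⟨y⁰, z⁰⟩ - ξ ϑ`. -/
noncomputable def yτ₀ (ϑ ξ : ℝ) (Φ : E → ℝ) (z₀ : E) : ℝ :=
  -⟪gradient Φ z₀, z₀⟫_ℝ - ξ * ϑ

/-- The parameter `μ(x, τ, y)`. -/
noncomputable def mu (A : X →ₗ[ℝ] E) (c : X) (Φ : E → ℝ) (z₀ : E) (ϑ ξ : ℝ)
    (p : X × ℝ × E) : ℝ :=
  p.2.1 / (ξ * ϑ) *
    (-yτ₀ ϑ ξ Φ z₀ - p.2.1 * ⟪c, p.1⟫_ℝ - ⟪p.2.2, A p.1 + (1 / p.2.1) • z₀⟫_ℝ)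

/-- `p = (x, τ, y)` is a point of `Q_DD` that is `κ`-close to the central path. The path consists
of points with `μ > 0`, and so do its neighbourhoods; for such points `(τ / μ) y` is in the
interior of `D_*`, the domain of `Φ_*`. -/
def IsClose (A : X →ₗ[ℝ] E) (c : X) (U : Set E) (Φ : E → ℝ) (z₀ : E) (ϑ ξ κ : ℝ)
    (p : X × ℝ × E) : Prop :=
  p ∈ QDD A c U Φ z₀ ∧ 0 < mu A c Φ z₀ ϑ ξ p ∧
    inverseNorm
      (hessian (conjugate U Φ) ((p.2.1 / mu A c Φ z₀ ϑ ξ p) • p.2.2))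
      (A p.1 + (1 / p.2.1) • z₀ -
        gradient (conjugate U Φ) ((p.2.1 / mu A c Φ z₀ ϑ ξ p) • p.2.2)) ≤ κ

end Path

end DomainDriven

/-!
Write `z = A x + z₀ / τ` for a point `(x, τ, y)`. The two linear constraints give the identity
`ξ ϑ (μ τ'² + μ' τ²) = ξ ϑ τ τ' (μ + μ') + τ τ' (τ' ⟨y, z' - z⟩ + τ ⟨y', z - z'⟩)`
(`mu_mul_sq_add_mu_mul_sq`), so everything rests on an upper bound for the cross terms. Put
`w = (τ / μ) y` and `v = Φ_*'(w)`, so that `Φ'(v) = w`. Then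
`⟨w, z' - z⟩ = ⟨Φ'(v), z' - v⟩ + ⟨Φ'(v), v - z⟩`.
The first term is at most `ϑ` for any `z'` in the domain (`dirDeriv_one_sub_le`). The second is at
most `√ϑ ‖z - v‖_{Φ''(v)}`, and since `[Φ_*''(w)]⁻¹ = Φ''(v)`, closeness to the path bounds this by
`√ϑ κ`, hence by `ϑ κ`, because `ϑ ≥ 1` unless the space is zero
(`one_le_parameter`). Inserting `(1 + κ) ϑ` for the cross terms gives the first inequality. For the
lower bound on `τ` the second point is the starting point `(0, 1, Φ'(z₀))`, where `μ = 1` and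
the cross term is bounded by `ϑ` directly.

The facts about `Φ_*` come from the standing hypothesis that `int D_*` is nonempty. It excludes
lines in the domain, and so makes `D²Φ` positive definite (`dirDeriv_two_pos`): a null direction of
`D²Φ` would stay null along the whole line by Grönwall's inequality, and `Φ` would be constant on
that line, which therefore could not leave the domain. Each `w ∈ int D_*` is attained as a gradient
(`exists_gradient_eq`), because the sublevel sets of `Φ - ⟨w, ·⟩` are compact. The inverse function
theorem then identifies `Φ_*'` near `w` with a local inverse of `Φ'`
(`gradient_hessian_conjugate`).
-/

namespace DomainDriven

/-! ### Directional derivatives -/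

section Directional

variable {E : Type*} [NormedAddCommGroup E] [InnerProductSpace ℝ E]

/-- The `k`-th directional derivative `D^k Φ(x)[h, …, h]`. -/
noncomputable def dirDeriv (k : ℕ) (Φ : E → ℝ) (x h : E) : ℝ :=
  iteratedFDeriv ℝ k Φ x (fun _ => h)

theorem dirDeriv_zero (Φ : E → ℝ) (x h : E) : dirDeriv 0 Φ x h = Φ x := by
  simp [dirDeriv]

theorem dirDeriv_one (Φ : E → ℝ) (x h : E) : dirDeriv 1 Φ x h = fderiv ℝ Φ x h := by
  simp [dirDeriv]

theorem dirDeriv_smul (k : ℕ) (Φ : E → ℝ) (x h : E) (r : ℝ) :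
    dirDeriv k Φ x (r • h) = r ^ k * dirDeriv k Φ x h := by
  simpa [dirDeriv] using
    (iteratedFDeriv ℝ k Φ x).map_smul_univ (fun _ => r) (fun _ => h)

theorem dirDeriv_one_eq_inner [CompleteSpace E] {Φ : E → ℝ} {x : E}
    (hd : DifferentiableAt ℝ Φ x) (h : E) : dirDeriv 1 Φ x h = ⟪gradient Φ x, h⟫_ℝ := by
  rw [dirDeriv_one, hd.hasGradientAt.hasFDerivAt.fderiv]
  simp

theorem hasDerivAt_dirDeriv_line {k : ℕ} {Φ : E → ℝ} {x h : E} {t : ℝ}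
    (hc : ContDiffAt ℝ (k + 1 : ℕ) Φ (x + t • h)) :
    HasDerivAt (fun s : ℝ => dirDeriv k Φ (x + s • h) h) (dirDeriv (k + 1) Φ (x + t • h) h) t := by
  have hd : DifferentiableAt ℝ (iteratedFDeriv ℝ k Φ) (x + t • h) :=
    hc.differentiableAt_iteratedFDeriv (by exact_mod_cast Nat.lt_succ_self k)
  have hl : HasDerivAt (fun s : ℝ => x + s • h) h t := by
    simpa using ((hasDerivAt_id t).smul_const h).const_add x
  have h1 := hd.hasFDerivAt.comp_hasDerivAt t hl
  have h2 := ((ContinuousMultilinearMap.apply ℝ (fun _ : Fin k => E) ℝ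
    (fun _ => h)).hasFDerivAt.comp_hasDerivAt t h1)
  have h3 : dirDeriv (k + 1) Φ (x + t • h) h =
      (ContinuousMultilinearMap.apply ℝ (fun _ : Fin k => E) ℝ (fun _ => h))
        (fderiv ℝ (iteratedFDeriv ℝ k Φ) (x + t • h) h) := by
    simp only [dirDeriv, iteratedFDeriv_succ_apply_left]
    rfl
  rw [h3]
  exact h2

end Directional

/-! ### Recession directions and the polar cone -/

section Recession

variable {E : Type*} [NormedAddCommGroup E] [InnerProductSpace ℝ E]

/-- A limit of `z k / s k` with `z k` in a closed convex set and `s k → ∞` is a recession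
direction of the set. -/
theorem mem_recessionCone_of_tendsto {C : Set E} (hc : Convex ℝ C) (hcl : IsClosed C)
    {z : ℕ → E} {s : ℕ → ℝ} {h : E} (hz : ∀ k, z k ∈ C) (hs : Tendsto s atTop atTop)
    (hh : Tendsto (fun k => (s k)⁻¹ • z k) atTop (𝓝 h)) : h ∈ recessionCone C := by
  intro x hx t ht
  have hs0 : Tendsto (fun k => t * (s k)⁻¹) atTop (𝓝 0) := by
    simpa using hs.inv_tendsto_atTop.const_mul t
  have hlim : Tendsto (fun k => (1 - t * (s k)⁻¹) • x + (t * (s k)⁻¹) • z k) atTop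
      (𝓝 (x + t • h)) := by
    have h1 : Tendsto (fun k => (1 - t * (s k)⁻¹) • x) atTop (𝓝 x) := by
      simpa using (hs0.const_sub 1).smul_const x
    simpa [mul_smul] using h1.add (hh.const_smul t)
  refine hcl.mem_of_tendsto hlim ?_
  filter_upwards [hs.eventually_gt_atTop 0, hs0.eventually (gt_mem_nhds zero_lt_one)] with k h0 h1
  exact hc hx (hz k) (by linarith) (by positivity) (by ring)

theorem mem_recessionCone_of_ray {C : Set E} (hc : Convex ℝ C) (hcl : IsClosed C) {x h : E}
    (hr : ∀ t : ℝ, 0 ≤ t → x + t • h ∈ C) : h ∈ recessionCone C := by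
  refine mem_recessionCone_of_tendsto hc hcl (z := fun k : ℕ => x + (k : ℝ) • h)
    (s := fun k : ℕ => (k : ℝ)) (fun k => hr _ k.cast_nonneg) tendsto_natCast_atTop_atTop ?_
  have h1 : Tendsto (fun k : ℕ => ((k : ℝ)⁻¹) • x + h) atTop (𝓝 h) := by
    simpa using (tendsto_inv_atTop_nhds_zero_nat (𝕜 := ℝ)).smul_const x |>.add_const h
  refine h1.congr' ?_
  filter_upwards [eventually_gt_atTop 0] with k hk
  have : (k : ℝ) ≠ 0 := by positivity
  simp [smul_add, smul_smul, this]

theorem exists_recession_direction [FiniteDimensional ℝ E] {C : Set E} (hc : Convex ℝ C)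
    (hcl : IsClosed C) (hb : ¬ Bornology.IsBounded C) : ∃ h ∈ recessionCone C, h ≠ 0 := by
  have h1 : ∀ k : ℕ, ∃ z ∈ C, (k : ℝ) + 1 < ‖z‖ := by
    intro k
    by_contra! hcon
    exact hb (isBounded_iff_forall_norm_le.2 ⟨_, hcon⟩)
  choose z hz hzk using h1
  have hz0 : ∀ k, ‖z k‖ ≠ 0 := fun k =>
    ((by positivity : (0 : ℝ) < (k : ℝ) + 1).trans (hzk k)).ne'
  obtain ⟨h, hh, φ, hφ, hlim⟩ := (isCompact_sphere (0 : E) 1).tendsto_subseq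
    (x := fun k => ‖z k‖⁻¹ • z k) (fun k => by simp [norm_smul, hz0 k])
  refine ⟨h, mem_recessionCone_of_tendsto hc hcl (z := z ∘ φ) (s := fun k => ‖z (φ k)‖)
    (fun k => hz _) ?_ hlim, ?_⟩
  · refine tendsto_atTop_mono (fun k => ?_) (tendsto_natCast_atTop_atTop.comp hφ.tendsto_atTop)
    have := hzk (φ k)
    simp only [Function.comp]
    linarith
  · rintro rfl
    simp at hh

/-- A functional in the interior of the polar of the recession cone is strictly negative on
nonzero recession directions. -/
theorem inner_neg_of_mem_interior_dualCone {C : Set E} {w h : E}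
    (hw : w ∈ interior (dualCone C)) (hh : h ∈ recessionCone C) (h0 : h ≠ 0) : ⟪w, h⟫_ℝ < 0 := by
  have hlim : Tendsto (fun s : ℝ => w + s • h) (𝓝[>] 0) (𝓝 w) := by
    have : Continuous fun s : ℝ => w + s • h := by fun_prop
    simpa using (this.tendsto 0).mono_left nhdsWithin_le_nhds
  obtain ⟨s, hs, hs0⟩ := ((hlim.eventually (mem_interior_iff_mem_nhds.1 hw)).and
    self_mem_nhdsWithin).exists
  have h1 : ⟪w + s • h, h⟫_ℝ ≤ 0 := hs h hh
  rw [inner_add_left, inner_smul_left, real_inner_self_eq_norm_sq] at h1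
  have h2 : 0 < s * ‖h‖ ^ 2 := mul_pos hs0 (by positivity)
  simp only [conj_trivial] at h1
  linarith

open scoped Pointwise in
/-- Positive multiples stay in the interior of the polar cone. -/
theorem smul_mem_interior_dualCone {C : Set E} {w : E} (hw : w ∈ interior (dualCone C)) {r : ℝ}
    (hr : 0 < r) : r • w ∈ interior (dualCone C) := by
  have hsub : r • interior (dualCone C) ⊆ dualCone C := by
    rintro _ ⟨u, hu, rfl⟩ h hh
    have := interior_subset hu h hh
    simp only [inner_smul_left, conj_trivial]
    exact mul_nonpos_of_nonneg_of_nonpos hr.le this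
  exact interior_maximal hsub (isOpen_interior.smul₀ hr.ne') (smul_mem_smul_set hw)

end Recession

/-! ### Self-concordant barriers along lines -/

section Barrier

variable {E : Type*} [NormedAddCommGroup E] [InnerProductSpace ℝ E]
  {ϑ : ℝ} {U : Set E} {Φ : E → ℝ}

theorem IsSelfConcordantBarrier.contDiffAt (hΦ : IsSelfConcordantBarrier ϑ U Φ) {x : E}
    (hx : x ∈ U) : ContDiffAt ℝ 3 Φ x :=
  hΦ.contDiffOn.contDiffAt (hΦ.isOpen.mem_nhds hx)

theorem IsSelfConcordantBarrier.differentiableAt (hΦ : IsSelfConcordantBarrier ϑ U Φ) {x : E}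
    (hx : x ∈ U) : DifferentiableAt ℝ Φ x :=
  (hΦ.contDiffAt hx).differentiableAt (by norm_num)

theorem IsSelfConcordantBarrier.interior_closure (hΦ : IsSelfConcordantBarrier ϑ U Φ) {z : E}
    (hz : z ∈ interior (closure U)) : interior (closure U) = U := by
  have hne : U.Nonempty := closure_nonempty_iff.1 ⟨z, interior_subset hz⟩
  rw [hΦ.convexOn.1.interior_closure_eq_interior_of_nonempty_interior
    (by rwa [hΦ.isOpen.interior_eq]), hΦ.isOpen.interior_eq]

theorem IsSelfConcordantBarrier.hasDerivAt_line (hΦ : IsSelfConcordantBarrier ϑ U Φ) {k : ℕ}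
    (hk : k < 3) {x h : E} {t : ℝ} (hx : x + t • h ∈ U) :
    HasDerivAt (fun s : ℝ => dirDeriv k Φ (x + s • h) h) (dirDeriv (k + 1) Φ (x + t • h) h) t :=
  hasDerivAt_dirDeriv_line ((hΦ.contDiffAt hx).of_le (by exact_mod_cast hk))

theorem IsSelfConcordantBarrier.hasDerivAt_line_zero (hΦ : IsSelfConcordantBarrier ϑ U Φ)
    {x h : E} {t : ℝ} (hx : x + t • h ∈ U) :
    HasDerivAt (fun s : ℝ => Φ (x + s • h)) (dirDeriv 1 Φ (x + t • h) h) t := by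
  simpa only [dirDeriv_zero] using hΦ.hasDerivAt_line (k := 0) (by norm_num) hx

theorem IsSelfConcordantBarrier.sq_dirDeriv_one_le (hΦ : IsSelfConcordantBarrier ϑ U Φ) {x : E}
    (hx : x ∈ U) (h : E) : dirDeriv 1 Φ x h ^ 2 ≤ ϑ * dirDeriv 2 Φ x h := by
  rw [dirDeriv_one]
  exact hΦ.parameter x hx h

theorem IsSelfConcordantBarrier.dirDeriv_two_nonneg (hΦ : IsSelfConcordantBarrier ϑ U Φ) {x : E}
    (hx : x ∈ U) (h : E) : 0 ≤ dirDeriv 2 Φ x h :=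
  nonneg_of_mul_nonneg_right ((sq_nonneg _).trans (hΦ.sq_dirDeriv_one_le hx h)) hΦ.pos

theorem IsSelfConcordantBarrier.abs_dirDeriv_three_le (hΦ : IsSelfConcordantBarrier ϑ U Φ) {x : E}
    (hx : x ∈ U) (h : E) :
    |dirDeriv 3 Φ x h| ≤ 2 * (dirDeriv 2 Φ x h * √(dirDeriv 2 Φ x h)) := by
  refine (hΦ.selfConcordant x hx h).trans_eq ?_
  have h0 := hΦ.dirDeriv_two_nonneg hx h
  change 2 * (dirDeriv 2 Φ x h) ^ (3 / 2 : ℝ) = _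
  rw [show (3 / 2 : ℝ) = 1 + 1 / 2 by norm_num, Real.rpow_add' h0 (by norm_num),
    Real.rpow_one, ← Real.sqrt_eq_rpow]

/-- On a segment in the domain the directional derivative is nondecreasing. -/
theorem IsSelfConcordantBarrier.monotoneOn_dirDeriv_one (hΦ : IsSelfConcordantBarrier ϑ U Φ)
    {x h : E} {s : Set ℝ} (hs : Convex ℝ s) (hU : ∀ t ∈ s, x + t • h ∈ U) :
    MonotoneOn (fun t : ℝ => dirDeriv 1 Φ (x + t • h) h) s := by
  refine monotoneOn_of_deriv_nonneg hs
    (fun t ht => (hΦ.hasDerivAt_line (by norm_num) (hU t ht)).continuousAt.continuousWithinAt)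
    (fun t ht => (hΦ.hasDerivAt_line (by norm_num)
      (hU t (interior_subset ht))).differentiableAt.differentiableWithinAt) (fun t ht => ?_)
  rw [(hΦ.hasDerivAt_line (k := 1) (by norm_num) (hU t (interior_subset ht))).deriv]
  exact hΦ.dirDeriv_two_nonneg (hU t (interior_subset ht)) h

theorem IsSelfConcordantBarrier.segment_mem (hΦ : IsSelfConcordantBarrier ϑ U Φ) {x z : E}
    (hx : x ∈ U) (hz : z ∈ U) {t : ℝ} (ht : t ∈ Icc (0 : ℝ) 1) : x + t • (z - x) ∈ U :=
  hΦ.convexOn.1.add_smul_sub_mem hx hz ht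

/-- The gradient inequality of the convex function `Φ`. -/
theorem IsSelfConcordantBarrier.add_dirDeriv_one_le (hΦ : IsSelfConcordantBarrier ϑ U Φ) {x z : E}
    (hx : x ∈ U) (hz : z ∈ U) : Φ x + dirDeriv 1 Φ x (z - x) ≤ Φ z := by
  have hmem := fun t (ht : t ∈ Icc (0 : ℝ) 1) => hΦ.segment_mem hx hz ht
  obtain ⟨t, ht, hd⟩ := exists_hasDerivAt_eq_slope (fun s : ℝ => Φ (x + s • (z - x)))
    (fun s => dirDeriv 1 Φ (x + s • (z - x)) (z - x)) zero_lt_one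
    (fun s hs => (hΦ.hasDerivAt_line_zero (hmem s hs)).continuousAt.continuousWithinAt)
    (fun s hs => hΦ.hasDerivAt_line_zero (hmem s (Ioo_subset_Icc_self hs)))
  have hm := hΦ.monotoneOn_dirDeriv_one (convex_Icc 0 1) hmem (left_mem_Icc.2 zero_le_one)
    (Ioo_subset_Icc_self ht) ht.1.le
  simp only [zero_smul, add_zero, one_smul, add_sub_cancel, sub_zero, div_one] at hm hd
  linarith

/-- The barrier parameter bounds `D Φ(x)[z - x]` over the whole domain: along the segment the
reciprocal of the directional derivative decreases at rate at least `1 / ϑ` and stays positive. -/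
theorem IsSelfConcordantBarrier.dirDeriv_one_sub_le (hΦ : IsSelfConcordantBarrier ϑ U Φ) {x z : E}
    (hx : x ∈ U) (hz : z ∈ U) : dirDeriv 1 Φ x (z - x) ≤ ϑ := by
  have hϑ := hΦ.pos
  rcases le_or_gt (dirDeriv 1 Φ x (z - x)) 0 with hneg | hpos
  · exact hneg.trans hϑ.le
  have hmem := fun t (ht : t ∈ Icc (0 : ℝ) 1) => hΦ.segment_mem hx hz ht
  set g : ℝ → ℝ := fun t => dirDeriv 1 Φ (x + t • (z - x)) (z - x) with hg
  have hgpos : ∀ t ∈ Icc (0 : ℝ) 1, 0 < g t := fun t ht => by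
    have hm := hΦ.monotoneOn_dirDeriv_one (convex_Icc 0 1) hmem (left_mem_Icc.2 zero_le_one) ht ht.1
    simp only [zero_smul, add_zero] at hm
    exact hpos.trans_le hm
  have hder : ∀ t ∈ Icc (0 : ℝ) 1, HasDerivAt (fun s => (g s)⁻¹)
      (-dirDeriv 2 Φ (x + t • (z - x)) (z - x) / g t ^ 2) t := fun t ht =>
    (hΦ.hasDerivAt_line (k := 1) (by norm_num) (hmem t ht)).inv (hgpos t ht).ne'
  obtain ⟨t, ht, hd⟩ := exists_hasDerivAt_eq_slope _ _ zero_lt_one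
    (fun s hs => (hder s hs).continuousAt.continuousWithinAt)
    (fun s hs => hder s (Ioo_subset_Icc_self hs))
  have ht' := Ioo_subset_Icc_self ht
  have h1 : 1 / ϑ ≤ dirDeriv 2 Φ (x + t • (z - x)) (z - x) / g t ^ 2 := by
    rw [div_le_div_iff₀ hϑ (pow_pos (hgpos t ht') 2)]
    have := hΦ.sq_dirDeriv_one_le (hmem t ht') (z - x)
    simp only [hg]
    linarith
  have h2 : 0 < (g 1)⁻¹ := inv_pos.2 (hgpos 1 (right_mem_Icc.2 zero_le_one))
  rw [neg_div] at hd
  have h3 : 1 / ϑ < (g 0)⁻¹ := by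
    have : (1 : ℝ) - 0 = 1 := by norm_num
    rw [this, div_one] at hd
    linarith
  have h4 : g 0 = dirDeriv 1 Φ x (z - x) := by simp [hg]
  rw [h4, ← one_div] at h3
  exact ((one_div_lt_one_div hϑ hpos).1 h3).le

/-- A ray leaving `U` has a first exit point, which lies on the boundary, so that `Φ` blows up
along the ray there. -/
theorem IsSelfConcordantBarrier.exists_exit (hΦ : IsSelfConcordantBarrier ϑ U Φ) {x h : E}
    (hx : x ∈ U) {t₁ : ℝ} (ht₁ : 0 ≤ t₁) (hout : x + t₁ • h ∉ U) :
    ∃ T : ℝ, 0 < T ∧ (∀ t ∈ Ico 0 T, x + t • h ∈ U) ∧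
      Tendsto (fun t : ℝ => Φ (x + t • h)) (𝓝[<] T) atTop := by
  have hcont : Continuous fun t : ℝ => x + t • h := by fun_prop
  set S : Set ℝ := Ici 0 ∩ (fun t : ℝ => x + t • h) ⁻¹' Uᶜ with hS
  have hScl : IsClosed S := isClosed_Ici.inter (hΦ.isOpen.isClosed_compl.preimage hcont)
  have hSb : BddBelow S := ⟨0, fun t ht => ht.1⟩
  have hTS : sInf S ∈ S := hScl.csInf_mem ⟨t₁, ht₁, hout⟩ hSb
  set T := sInf S
  have hT0 : 0 < T := by
    refine lt_of_le_of_ne hTS.1 fun h0 => hTS.2 ?_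
    rw [← h0]
    simpa using hx
  have hin : ∀ t ∈ Ico 0 T, x + t • h ∈ U := fun t ht => by
    by_contra hn
    exact absurd (csInf_le hSb (show t ∈ S from ⟨ht.1, hn⟩)) (not_le.2 ht.2)
  have hev : ∀ᶠ t in 𝓝[<] T, x + t • h ∈ U := by
    filter_upwards [Ioo_mem_nhdsLT hT0] with t ht using hin t ⟨ht.1.le, ht.2⟩
  have hlim : Tendsto (fun t : ℝ => x + t • h) (𝓝[<] T) (𝓝 (x + T • h)) :=
    (hcont.tendsto T).mono_left nhdsWithin_le_nhds
  have hfr : x + T • h ∈ frontier U := by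
    rw [hΦ.isOpen.frontier_eq]
    exact ⟨mem_closure_of_tendsto hlim hev, hTS.2⟩
  exact ⟨T, hT0, hin, (hΦ.barrier _ hfr).comp (tendsto_nhdsWithin_iff.2 ⟨hlim, hev⟩)⟩

/-- If `D²Φ` vanishes at a point in some direction, then the ray in that direction stays in the
domain: by self-concordance and Grönwall `D²Φ` vanishes along the ray, then so does `DΦ`, and `Φ`
cannot blow up. -/
theorem IsSelfConcordantBarrier.ray_mem_of_dirDeriv_two_eq_zero
    (hΦ : IsSelfConcordantBarrier ϑ U Φ) {x h : E} (hx : x ∈ U) (h0 : dirDeriv 2 Φ x h = 0)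
    {t : ℝ} (ht : 0 ≤ t) : x + t • h ∈ U := by
  by_contra hout
  obtain ⟨T, hT, hin, hlim⟩ := hΦ.exists_exit hx ht hout
  have hzero : ∀ s ∈ Ico 0 T, dirDeriv 1 Φ (x + s • h) h = 0 := by
    intro s hs
    have hmem : ∀ r ∈ Icc 0 s, x + r • h ∈ U := fun r hr => hin r ⟨hr.1, hr.2.trans_lt hs.2⟩
    have hcont : ContinuousOn (fun r : ℝ => dirDeriv 2 Φ (x + r • h) h) (Icc 0 s) := fun r hr =>
      (hΦ.hasDerivAt_line (k := 2) (by norm_num) (hmem r hr)).continuousAt.continuousWithinAt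
    obtain ⟨M, hM⟩ := (isCompact_Icc.image_of_continuousOn hcont).bddAbove
    have h2 := eq_zero_of_abs_deriv_le_mul_abs_self_of_eq_zero_right (K := 2 * √M) hcont
      (fun r hr => (hΦ.hasDerivAt_line (k := 2) (by norm_num)
        (hmem r (Ico_subset_Icc_self hr))).hasDerivWithinAt) (by simpa using h0)
      (fun r hr => by
        have hr' := hmem r (Ico_subset_Icc_self hr)
        have hn := hΦ.dirDeriv_two_nonneg hr' h
        rw [Real.norm_eq_abs, Real.norm_eq_abs, abs_of_nonneg hn]
        refine (hΦ.abs_dirDeriv_three_le hr' h).trans ?_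
        have : √(dirDeriv 2 Φ (x + r • h) h) ≤ √M :=
          Real.sqrt_le_sqrt (hM ⟨r, Ico_subset_Icc_self hr, rfl⟩)
        nlinarith) s ⟨hs.1, le_rfl⟩
    have h3 := hΦ.sq_dirDeriv_one_le (hin s hs) h
    rw [h2, mul_zero] at h3
    exact pow_eq_zero_iff two_ne_zero |>.1 (le_antisymm h3 (sq_nonneg _))
  have hconst : ∀ s ∈ Ico 0 T, Φ (x + s • h) = Φ x := by
    intro s hs
    have := constant_of_has_deriv_right_zero (f := fun r : ℝ => Φ (x + r • h)) (a := 0) (b := s)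
      (fun r hr => (hΦ.hasDerivAt_line_zero
        (hin r ⟨hr.1, hr.2.trans_lt hs.2⟩)).continuousAt.continuousWithinAt)
      (fun r hr => by
        have hr' : r ∈ Ico 0 T := ⟨hr.1, hr.2.trans hs.2⟩
        have := (hΦ.hasDerivAt_line_zero (hin r hr')).hasDerivWithinAt (s := Ici r)
        rwa [hzero r hr'] at this) s ⟨hs.1, le_rfl⟩
    simpa using this
  obtain ⟨s, hs1, hs2⟩ := ((hlim.eventually (eventually_gt_atTop (Φ x))).and
    (Ioo_mem_nhdsLT hT)).exists
  exact hs1.ne' (hconst s ⟨hs2.1.le, hs2.2⟩)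

/-- A line cannot stay in `U` if `D_*` has an interior point. -/
theorem IsSelfConcordantBarrier.eq_zero_of_line_mem (hΦ : IsSelfConcordantBarrier ϑ U Φ)
    {x h w : E} (hw : w ∈ interior (dualCone (closure U)))
    (hp : ∀ t : ℝ, 0 ≤ t → x + t • h ∈ U) (hn : ∀ t : ℝ, 0 ≤ t → x + t • (-h) ∈ U) : h = 0 := by
  by_contra h0
  have hc := hΦ.convexOn.1.closure
  have h1 := inner_neg_of_mem_interior_dualCone hw
    (mem_recessionCone_of_ray hc isClosed_closure fun t ht => subset_closure (hp t ht)) h0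
  have h2 := inner_neg_of_mem_interior_dualCone hw
    (mem_recessionCone_of_ray hc isClosed_closure fun t ht => subset_closure (hn t ht))
    (neg_ne_zero.2 h0)
  rw [inner_neg_right] at h2
  linarith

theorem IsSelfConcordantBarrier.dirDeriv_two_pos (hΦ : IsSelfConcordantBarrier ϑ U Φ)
    {x h w : E} (hw : w ∈ interior (dualCone (closure U))) (hx : x ∈ U) (h0 : h ≠ 0) :
    0 < dirDeriv 2 Φ x h := by
  refine (hΦ.dirDeriv_two_nonneg hx h).lt_of_ne' fun hz => h0 ?_
  refine hΦ.eq_zero_of_line_mem hw (fun t => hΦ.ray_mem_of_dirDeriv_two_eq_zero hx hz)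
    (fun t => hΦ.ray_mem_of_dirDeriv_two_eq_zero hx ?_)
  have := dirDeriv_smul 2 Φ x h (-1)
  simpa [hz] using this

/-- The parameter of a nondegenerate barrier is at least `1`. Along a ray leaving the domain put
`f = φ' / √φ''`, so that `|f| ≤ √ϑ`. Self-concordance gives
`f' ≥ √φ'' - |φ'| ≥ (1 - √ϑ) √φ'' ≥ (1 - √ϑ) φ'`
if `ϑ < 1`, so that `f` would grow at least as fast as `(1 - √ϑ) φ`, which is unbounded. -/
theorem IsSelfConcordantBarrier.one_le_parameter [Nontrivial E]
    (hΦ : IsSelfConcordantBarrier ϑ U Φ) {x w : E}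
    (hw : w ∈ interior (dualCone (closure U))) (hx : x ∈ U) : 1 ≤ ϑ := by
  by_contra! hϑ
  obtain ⟨h, h0, t₁, ht₁, hout⟩ : ∃ h : E, h ≠ 0 ∧ ∃ t : ℝ, 0 ≤ t ∧ x + t • h ∉ U := by
    by_contra! hcon
    obtain ⟨h, h0⟩ := exists_ne (0 : E)
    exact h0 (hΦ.eq_zero_of_line_mem hw (hcon h h0) (hcon (-h) (neg_ne_zero.2 h0)))
  obtain ⟨T, hT, hin, hlim⟩ := hΦ.exists_exit hx ht₁ hout
  have hs1 : √ϑ < 1 := by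
    rw [Real.sqrt_lt' one_pos]
    simpa using hϑ
  have hbound : ∀ t ∈ Ico 0 T, |dirDeriv 1 Φ (x + t • h) h| ≤
      √ϑ * √(dirDeriv 2 Φ (x + t • h) h) := fun t ht => by
    rw [← Real.sqrt_mul hΦ.pos.le]
    exact Real.abs_le_sqrt (hΦ.sq_dirDeriv_one_le (hin t ht) h)
  set f : ℝ → ℝ := fun t => dirDeriv 1 Φ (x + t • h) h / √(dirDeriv 2 Φ (x + t • h) h) with hf
  have hfle : ∀ t ∈ Ico 0 T, |f t| ≤ √ϑ := fun t ht => by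
    have hp := Real.sqrt_pos.2 (hΦ.dirDeriv_two_pos hw (hin t ht) h0)
    simp only [hf]
    rw [abs_div, abs_of_pos hp, div_le_iff₀ hp]
    exact hbound t ht
  have hder : ∀ t ∈ Ico 0 T, ∃ d, HasDerivAt (fun t => f t - (1 - √ϑ) * Φ (x + t • h)) d t ∧
      0 ≤ d := fun t ht => by
    have hp := hΦ.dirDeriv_two_pos hw (hin t ht) h0
    have hsp := Real.sqrt_pos.2 hp
    have d1 := hΦ.hasDerivAt_line (k := 1) (h := h) (by norm_num) (hin t ht)
    have d2 := (hΦ.hasDerivAt_line (k := 2) (h := h) (by norm_num) (hin t ht)).sqrt hp.ne'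
    have d0 := hΦ.hasDerivAt_line_zero (hin t ht)
    refine ⟨_, (d1.div d2 hsp.ne').sub (d0.const_mul (1 - √ϑ)), ?_⟩
    have hb := hbound t ht
    have h3 := hΦ.abs_dirDeriv_three_le (hin t ht) h
    have hsq := Real.mul_self_sqrt hp.le
    norm_num only at *
    generalize dirDeriv 1 Φ (x + t • h) h = p at *
    generalize dirDeriv 2 Φ (x + t • h) h = q at *
    generalize dirDeriv 3 Φ (x + t • h) h = r at *
    generalize √q = s at *
    subst hsq
    have h4 : |p * r| ≤ |p| * (2 * (s * s * s)) := by
      rw [abs_mul]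
      exact mul_le_mul_of_nonneg_left h3 (abs_nonneg _)
    have h5 : |p * (r / (2 * s))| ≤ |p| * (s * s) := by
      rw [← mul_div_assoc, abs_div, abs_of_pos (by positivity : 0 < 2 * s),
        div_le_iff₀ (by positivity)]
      calc |p * r| ≤ _ := h4
        _ = _ := by ring
    have h6 : s - |p| ≤ (s * s * s - p * (r / (2 * s))) / s ^ 2 := by
      rw [le_div_iff₀ (by positivity)]
      nlinarith [le_abs_self (p * (r / (2 * s)))]
    have h7 : p ≤ s := (le_abs_self p).trans (hb.trans (by nlinarith))
    nlinarith
  have hmono : ∀ t ∈ Ico 0 T, f 0 - (1 - √ϑ) * Φ x ≤ f t - (1 - √ϑ) * Φ (x + t • h) := by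
    intro t ht
    have := monotoneOn_of_deriv_nonneg (f := fun t => f t - (1 - √ϑ) * Φ (x + t • h))
      (convex_Ico 0 T)
      (fun r hr => (hder r hr).choose_spec.1.continuousAt.continuousWithinAt)
      (fun r hr =>
        (hder r (interior_subset hr)).choose_spec.1.differentiableAt.differentiableWithinAt)
      (fun r hr => by
        rw [(hder r (interior_subset hr)).choose_spec.1.deriv]
        exact (hder r (interior_subset hr)).choose_spec.2)
      (left_mem_Ico.2 hT) ht ht.1
    simpa using this
  obtain ⟨t, ht1, ht2⟩ := ((hlim.eventually (eventually_gt_atTop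
    (Φ x + 2 / (1 - √ϑ)))).and (Ioo_mem_nhdsLT hT)).exists
  have ht : t ∈ Ico 0 T := ⟨ht2.1.le, ht2.2⟩
  have h1 := abs_le.1 (hfle t ht)
  have h2 := abs_le.1 (hfle 0 (left_mem_Ico.2 hT))
  have h3 := hmono t ht
  have h4 : 0 < 1 - √ϑ := by linarith
  have h5 : (1 - √ϑ) * (Φ x + 2 / (1 - √ϑ)) < (1 - √ϑ) * Φ (x + t • h) :=
    mul_lt_mul_of_pos_left ht1 h4
  rw [mul_add, mul_div_cancel₀ _ h4.ne'] at h5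
  linarith

end Barrier

/-! ### The Legendre-Fenchel conjugate -/

section Conjugate

variable {E : Type*} [NormedAddCommGroup E] [InnerProductSpace ℝ E]
  {ϑ : ℝ} {U : Set E} {Φ : E → ℝ}

theorem IsSelfConcordantBarrier.convex_sublevel (hΦ : IsSelfConcordantBarrier ϑ U Φ) (w : E)
    (a : ℝ) : Convex ℝ {z | z ∈ U ∧ Φ z - ⟪w, z⟫_ℝ ≤ a} :=
  (hΦ.convexOn.sub ((innerSL ℝ w).toLinearMap.concaveOn hΦ.convexOn.1)).convex_le a

/-- The sublevel sets are closed in the whole space because `Φ` blows up at the boundary of `U`. -/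
theorem IsSelfConcordantBarrier.isClosed_sublevel (hΦ : IsSelfConcordantBarrier ϑ U Φ) (w : E)
    (a : ℝ) : IsClosed {z | z ∈ U ∧ Φ z - ⟪w, z⟫_ℝ ≤ a} := by
  refine isClosed_of_closure_subset fun x hx => ?_
  set S := {z | z ∈ U ∧ Φ z - ⟪w, z⟫_ℝ ≤ a} with hS
  have hSU : S ⊆ U := fun z hz => hz.1
  have hne : (𝓝[S] x).NeBot := mem_closure_iff_nhdsWithin_neBot.1 hx
  have hinner : Tendsto (fun z => ⟪w, z⟫_ℝ) (𝓝[S] x) (𝓝 ⟪w, x⟫_ℝ) :=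
    ((by fun_prop : Continuous fun z => ⟪w, z⟫_ℝ).tendsto x).mono_left nhdsWithin_le_nhds
  by_cases hxU : x ∈ U
  · have hlim : Tendsto (fun z => Φ z - ⟪w, z⟫_ℝ) (𝓝[S] x) (𝓝 (Φ x - ⟪w, x⟫_ℝ)) :=
      ((hΦ.differentiableAt hxU).continuousAt.tendsto.mono_left nhdsWithin_le_nhds).sub hinner
    exact ⟨hxU, le_of_tendsto hlim (eventually_mem_nhdsWithin.mono fun z hz => hz.2)⟩
  · have hfr : x ∈ frontier U := by
      rw [hΦ.isOpen.frontier_eq]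
      exact ⟨closure_mono hSU hx, hxU⟩
    have h1 := ((hΦ.barrier x hfr).mono_left (nhdsWithin_mono x hSU)).eventually
      (eventually_gt_atTop (a + (⟪w, x⟫_ℝ + 1)))
    have h2 := hinner.eventually (gt_mem_nhds (lt_add_one _))
    obtain ⟨z, hz1, hz2, hz3⟩ := (h1.and (h2.and eventually_mem_nhdsWithin)).exists
    have := hz3.2
    linarith

/-- For `w` in the interior of `D_*` the sublevel sets of `Φ - ⟨w, ·⟩` are bounded. Along a
recession direction `h` of such a set `⟨w, ·⟩` decreases linearly, hence so does `Φ`; but the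
barrier parameter forces `D Φ(x + t h)[h] ≥ -ϑ / t`, so `Φ` decreases slower than linearly. -/
theorem IsSelfConcordantBarrier.isBounded_sublevel [FiniteDimensional ℝ E]
    (hΦ : IsSelfConcordantBarrier ϑ U Φ) {w : E} (hw : w ∈ interior (dualCone (closure U)))
    {x : E} (hx : x ∈ U) :
    Bornology.IsBounded {z | z ∈ U ∧ Φ z - ⟪w, z⟫_ℝ ≤ Φ x - ⟪w, x⟫_ℝ} := by
  by_contra hb
  obtain ⟨h, hrec, h0⟩ := exists_recession_direction (hΦ.convex_sublevel w _)
    (hΦ.isClosed_sublevel w _) hb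
  have hray : ∀ t : ℝ, 0 ≤ t → x + t • h ∈ U ∧
      Φ (x + t • h) - ⟪w, x + t • h⟫_ℝ ≤ Φ x - ⟪w, x⟫_ℝ := hrec x ⟨hx, le_rfl⟩
  have hneg := inner_neg_of_mem_interior_dualCone hw (mem_recessionCone_of_ray
    hΦ.convexOn.1.closure isClosed_closure fun t ht => subset_closure (hray t ht).1) h0
  set ε := -⟪w, h⟫_ℝ with hε
  have hε0 : 0 < ε := by linarith
  have hϑ := hΦ.pos
  have hdir : ∀ (y : E) (r : ℝ), dirDeriv 1 Φ y (r • h) = r * dirDeriv 1 Φ y h := fun y r => by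
    rw [dirDeriv_smul, pow_one]
  -- At `t₀ = 2ϑ/ε` the slope of `Φ` along the ray is at least `-ϑ/t₀ = -ε/2`.
  set t₀ := 2 * ϑ / ε with ht₀
  have ht₀0 : 0 < t₀ := by positivity
  have hslope : -(ε / 2) ≤ dirDeriv 1 Φ (x + t₀ • h) h := by
    have h1 := hΦ.dirDeriv_one_sub_le (hray t₀ ht₀0.le).1 hx
    rw [show x - (x + t₀ • h) = (-t₀) • h by rw [neg_smul]; abel, hdir] at h1
    have h2 : t₀ * (ε / 2) = ϑ := by
      rw [ht₀]
      field_simp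
    nlinarith
  have hlow : ∀ s : ℝ, 0 ≤ s → Φ (x + t₀ • h) - ε / 2 * s ≤ Φ (x + (t₀ + s) • h) := fun s hs => by
    have h1 := hΦ.add_dirDeriv_one_le (hray t₀ ht₀0.le).1 (hray (t₀ + s) (by positivity)).1
    rw [show x + (t₀ + s) • h - (x + t₀ • h) = s • h by rw [add_smul]; abel, hdir] at h1
    nlinarith
  have hup : ∀ s : ℝ, 0 ≤ s → Φ (x + (t₀ + s) • h) ≤ Φ x - ε * (t₀ + s) := fun s hs => by
    have h1 := (hray (t₀ + s) (by positivity)).2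
    rw [inner_add_right, inner_smul_right] at h1
    rw [hε]
    linarith
  set s := 2 * (|Φ x - Φ (x + t₀ • h)|) / ε with hs
  have hs0 : 0 ≤ s := by positivity
  have h1 := hlow s hs0
  have h2 := hup s hs0
  have h3 : ε / 2 * s = |Φ x - Φ (x + t₀ • h)| := by
    rw [hs]
    field_simp
  nlinarith [le_abs_self (Φ x - Φ (x + t₀ • h)), mul_pos hε0 ht₀0]

/-- Every `w` in the interior of `D_*` is a gradient of `Φ`. -/
theorem IsSelfConcordantBarrier.exists_gradient_eq [FiniteDimensional ℝ E]
    (hΦ : IsSelfConcordantBarrier ϑ U Φ) (hne : U.Nonempty) {w : E}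
    (hw : w ∈ interior (dualCone (closure U))) : ∃ v ∈ U, gradient Φ v = w := by
  obtain ⟨x, hx⟩ := hne
  have hcomp : IsCompact {z | z ∈ U ∧ Φ z - ⟪w, z⟫_ℝ ≤ Φ x - ⟪w, x⟫_ℝ} :=
    Metric.isCompact_of_isClosed_isBounded (hΦ.isClosed_sublevel w _) (hΦ.isBounded_sublevel hw hx)
  have hder : ∀ z ∈ U, HasFDerivAt (fun z => Φ z - ⟪w, z⟫_ℝ) (fderiv ℝ Φ z - innerSL ℝ w) z :=
    fun z hz => (hΦ.differentiableAt hz).hasFDerivAt.sub (innerSL ℝ w).hasFDerivAt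
  obtain ⟨v, hv, hmin⟩ := hcomp.exists_isMinOn ⟨x, hx, le_rfl⟩
    (fun z hz => (hder z hz.1).continuousAt.continuousWithinAt)
  have hloc : IsLocalMin (fun z => Φ z - ⟪w, z⟫_ℝ) v := by
    filter_upwards [hΦ.isOpen.mem_nhds hv.1] with z hz
    by_cases hzS : Φ z - ⟪w, z⟫_ℝ ≤ Φ x - ⟪w, x⟫_ℝ
    · exact hmin ⟨hz, hzS⟩
    · exact hv.2.trans (not_le.1 hzS).le
  refine ⟨v, hv.1, ext_inner_right ℝ fun u => ?_⟩
  have h1 := sub_eq_zero.1 (hloc.hasFDerivAt_eq_zero (hder v hv.1))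
  rw [← dirDeriv_one_eq_inner (hΦ.differentiableAt hv.1), dirDeriv_one, h1, innerSL_apply_apply]

variable [FiniteDimensional ℝ E]

theorem IsSelfConcordantBarrier.conjugate_gradient (hΦ : IsSelfConcordantBarrier ϑ U Φ) {x : E}
    (hx : x ∈ U) :
    conjugate U Φ (gradient Φ x) = ⟪gradient Φ x, x⟫_ℝ - Φ x := by
  have hgr : IsGreatest (range fun z : U => ⟪gradient Φ x, (z : E)⟫_ℝ - Φ z)
      (⟪gradient Φ x, x⟫_ℝ - Φ x) := by
    refine ⟨⟨⟨x, hx⟩, rfl⟩, ?_⟩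
    rintro _ ⟨z, rfl⟩
    have := hΦ.add_dirDeriv_one_le hx z.2
    rw [dirDeriv_one_eq_inner (hΦ.differentiableAt hx), inner_sub_right] at this
    simp only
    linarith
  exact hgr.csSup_eq

theorem IsSelfConcordantBarrier.contDiffAt_gradient (hΦ : IsSelfConcordantBarrier ϑ U Φ) {x : E}
    (hx : x ∈ U) : ContDiffAt ℝ 2 (gradient Φ) x :=
  (InnerProductSpace.toDual ℝ E).symm.contDiff.contDiffAt.comp x
    ((hΦ.contDiffAt hx).fderiv_right (m := 2) (by norm_num))

theorem IsSelfConcordantBarrier.hasFDerivAt_gradient (hΦ : IsSelfConcordantBarrier ϑ U Φ) {x : E}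
    (hx : x ∈ U) : HasFDerivAt (gradient Φ) (hessian Φ x) x :=
  ((hΦ.contDiffAt_gradient hx).differentiableAt (by norm_num)).hasFDerivAt

theorem IsSelfConcordantBarrier.inner_hessian (hΦ : IsSelfConcordantBarrier ϑ U Φ) {x : E}
    (hx : x ∈ U) (h : E) : ⟪h, hessian Φ x h⟫_ℝ = dirDeriv 2 Φ x h := by
  have hl : HasDerivAt (fun s : ℝ => x + s • h) h 0 := by
    simpa using ((hasDerivAt_id (0 : ℝ)).smul_const h).const_add x
  have hx0 : x + (0 : ℝ) • h = x := by simp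
  have h1 : HasDerivAt (fun s : ℝ => gradient Φ (x + s • h)) (hessian Φ x h) 0 :=
    (hΦ.hasFDerivAt_gradient hx).comp_hasDerivAt_of_eq 0 hl hx0.symm
  have h2 : HasDerivAt (fun s : ℝ => ⟪h, gradient Φ (x + s • h)⟫_ℝ) ⟪h, hessian Φ x h⟫_ℝ 0 :=
    (innerSL ℝ h).hasFDerivAt.comp_hasDerivAt 0 h1
  have h3 := hΦ.hasDerivAt_line (k := 1) (h := h) (t := 0) (by norm_num) (by rwa [hx0])
  rw [hx0] at h3
  refine h2.unique (h3.congr_of_eventuallyEq ?_)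
  have hU : ∀ᶠ s : ℝ in 𝓝 0, x + s • h ∈ U :=
    hl.continuousAt.eventually (by simpa using hΦ.isOpen.eventually_mem hx)
  filter_upwards [hU] with s hs
  rw [dirDeriv_one_eq_inner (hΦ.differentiableAt hs), real_inner_comm]

/-- Legendre duality: `Φ_*'` is locally inverse to `Φ'`, so that at `w = Φ'(v)` it takes the value
`v` and `Φ_*''(w)` is the inverse of `Φ''(v)`. -/
theorem IsSelfConcordantBarrier.gradient_hessian_conjugate (hΦ : IsSelfConcordantBarrier ϑ U Φ)
    {v : E} (hv : v ∈ U) (hw : gradient Φ v ∈ interior (dualCone (closure U))) :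
    gradient (conjugate U Φ) (gradient Φ v) = v ∧
      (hessian (conjugate U Φ) (gradient Φ v)).inverse = hessian Φ v := by
  have hinj : Function.Injective (hessian Φ v : E →ₗ[ℝ] E) := by
    refine (injective_iff_map_eq_zero _).2 fun h hh => ?_
    by_contra h0
    have h1 := hΦ.dirDeriv_two_pos hw hv h0
    rw [← hΦ.inner_hessian hv, show hessian Φ v h = 0 from hh, inner_zero_right] at h1
    exact lt_irrefl _ h1
  set e : E ≃L[ℝ] E := (LinearEquiv.ofInjectiveEndo _ hinj).toContinuousLinearEquiv with he
  have hee : (e : E →L[ℝ] E) = hessian Φ v := by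
    ext u
    rfl
  have hder : HasFDerivAt (gradient Φ) (e : E →L[ℝ] E) v := hee ▸ hΦ.hasFDerivAt_gradient hv
  have hc := hΦ.contDiffAt_gradient hv
  have hstrict := hc.hasStrictFDerivAt' hder (by norm_num)
  set g : E → E := hc.localInverse hder (by norm_num) with hg
  have hgv : g (gradient Φ v) = v := hc.localInverse_apply_image hder (by norm_num)
  have hgc : ContDiffAt ℝ 2 g (gradient Φ v) := hc.to_localInverse hder (by norm_num)
  have hgd : HasFDerivAt g (e.symm : E →L[ℝ] E) (gradient Φ v) :=
    hstrict.to_localInverse.hasFDerivAt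
  have hright : ∀ᶠ y in 𝓝 (gradient Φ v), gradient Φ (g y) = y :=
    hstrict.eventually_right_inverse
  have hgU : ∀ᶠ y in 𝓝 (gradient Φ v), g y ∈ U :=
    hgc.continuousAt.eventually (by rw [hgv]; exact hΦ.isOpen.mem_nhds hv)
  have hgdiff : ∀ᶠ y in 𝓝 (gradient Φ v), DifferentiableAt ℝ g y :=
    (hgc.eventually (by simp)).mono fun y hy => hy.differentiableAt (by norm_num)
  have hgrad : gradient (conjugate U Φ) =ᶠ[𝓝 (gradient Φ v)] g := by
    filter_upwards [(hright.and hgU).eventually_nhds, hgdiff] with y hy hd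
    have hval : conjugate U Φ =ᶠ[𝓝 y] fun y' => ⟪y', g y'⟫_ℝ - Φ (g y') :=
      hy.mono fun y' hy' => by
        have := hΦ.conjugate_gradient hy'.2
        rwa [hy'.1] at this
    obtain ⟨hyr, hyU⟩ := hy.self_of_nhds
    refine HasGradientAt.gradient (HasGradientAt.congr_of_eventuallyEq ?_ hval)
    have h1 := ((hasFDerivAt_id y).inner ℝ hd.hasFDerivAt).sub
      ((hΦ.differentiableAt hyU).hasFDerivAt.comp y hd.hasFDerivAt)
    rw [hasGradientAt_iff_hasFDerivAt]
    refine h1.congr_fderiv ?_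
    ext k
    -- The terms containing the derivative of `g` cancel, as `Φ'(g y) = y`.
    have h2 := dirDeriv_one_eq_inner (hΦ.differentiableAt hyU) (fderiv ℝ g y k)
    rw [dirDeriv_one, hyr] at h2
    simp [h2, real_inner_comm]
  refine ⟨hgrad.self_of_nhds.trans hgv, ?_⟩
  rw [show hessian (conjugate U Φ) (gradient Φ v) = (e.symm : E →L[ℝ] E) from
    hgrad.fderiv_eq.trans hgd.fderiv, ContinuousLinearMap.inverse_equiv,
    ContinuousLinearEquiv.symm_symm, hee]

end Conjugate

/-! ### Points close to the central path -/

section CentralPath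

variable {X E : Type*} [NormedAddCommGroup X] [InnerProductSpace ℝ X] [FiniteDimensional ℝ X]
  [NormedAddCommGroup E] [InnerProductSpace ℝ E] [FiniteDimensional ℝ E]
  {A : X →ₗ[ℝ] E} {c : X} {ϑ : ℝ} {U : Set E} {Φ : E → ℝ} {z₀ : E} {ξ κ : ℝ}

/-- With `v = Φ_*'(w)` the bound is the sum of `⟨Φ'(v), z' - v⟩ ≤ ϑ` and
`⟨Φ'(v), v - z⟩ ≤ √ϑ ‖z - v‖_{Φ''(v)} ≤ √ϑ κ ≤ ϑ κ`, where `ϑ ≥ 1` is used. -/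
theorem IsSelfConcordantBarrier.inner_sub_le_of_inverseNorm_le
    (hΦ : IsSelfConcordantBarrier ϑ U Φ) {w z z' : E}
    (hw : w ∈ interior (dualCone (closure U))) (hz' : z' ∈ U)
    (hκ : inverseNorm (hessian (conjugate U Φ) w) (z - gradient (conjugate U Φ) w) ≤ κ) :
    ⟪w, z' - z⟫_ℝ ≤ (1 + κ) * ϑ := by
  have hϑ := hΦ.pos
  have hκ0 : 0 ≤ κ := (Real.sqrt_nonneg _).trans hκ
  rcases subsingleton_or_nontrivial E with hE | hE
  · rw [Subsingleton.elim (z' - z) 0, inner_zero_right]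
    positivity
  have hϑ1 := hΦ.one_le_parameter hw hz'
  obtain ⟨v, hv, rfl⟩ := hΦ.exists_gradient_eq ⟨z', hz'⟩ hw
  obtain ⟨hg, hH⟩ := hΦ.gradient_hessian_conjugate hv hw
  rw [inverseNorm, hH, hg, hΦ.inner_hessian hv] at hκ
  have h1 := hΦ.dirDeriv_one_sub_le hv hz'
  have h2 : |dirDeriv 1 Φ v (z - v)| ≤ ϑ * κ := by
    calc |dirDeriv 1 Φ v (z - v)| ≤ √(ϑ * dirDeriv 2 Φ v (z - v)) :=
          Real.abs_le_sqrt (hΦ.sq_dirDeriv_one_le hv _)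
      _ = √ϑ * √(dirDeriv 2 Φ v (z - v)) := Real.sqrt_mul hϑ.le _
      _ ≤ ϑ * κ := by
          gcongr
          exact Real.sqrt_le_self_iff.2 (Or.inr hϑ1)
  rw [dirDeriv_one_eq_inner (hΦ.differentiableAt hv)] at h1 h2
  have h3 := neg_abs_le ⟪gradient Φ v, z - v⟫_ℝ
  have h4 : z' - z = (z' - v) - (z - v) := by abel
  rw [h4, inner_sub_right]
  linarith

theorem inner_map_add_smul {y : E} {τ : ℝ}
    (hy : A.adjoint y - A.adjoint (gradient Φ z₀) = -((τ - 1) • c)) (x : X) (r : ℝ) :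
    ⟪y, A x + r • z₀⟫_ℝ =
      ⟪gradient Φ z₀, A x⟫_ℝ - (τ - 1) * ⟪c, x⟫_ℝ + r * ⟪y, z₀⟫_ℝ := by
  have h1 : ⟪A.adjoint y, x⟫_ℝ = ⟪A.adjoint (gradient Φ z₀) + -((τ - 1) • c), x⟫_ℝ := by
    rw [← hy]
    congr 1
    abel
  rw [inner_add_left, inner_neg_left, inner_smul_left, LinearMap.adjoint_inner_left,
    LinearMap.adjoint_inner_left] at h1
  simp only [conj_trivial] at h1
  rw [inner_add_right, inner_smul_right, h1]
  ring

/-- The identity behind the theorem: for two primal-dual points satisfying the linear constraints,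
with `z = A x + z₀ / τ`, the quantity `μ τ'² + μ' τ²` differs from `τ τ' (μ + μ')` only by the
cross terms `⟨y, z' - z⟩` and `⟨y', z - z'⟩`. -/
theorem mu_mul_sq_add_mu_mul_sq (hξϑ : ξ * ϑ ≠ 0) {x x' : X} {τ τ' : ℝ} {y y' : E} (hτ : 0 < τ)
    (hτ' : 0 < τ') (hy : A.adjoint y - A.adjoint (gradient Φ z₀) = -((τ - 1) • c))
    (hy' : A.adjoint y' - A.adjoint (gradient Φ z₀) = -((τ' - 1) • c)) :
    ξ * ϑ * (mu A c Φ z₀ ϑ ξ (x, τ, y) * τ' ^ 2 + mu A c Φ z₀ ϑ ξ (x', τ', y') * τ ^ 2) =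
      ξ * ϑ * (τ * τ' * (mu A c Φ z₀ ϑ ξ (x, τ, y) + mu A c Φ z₀ ϑ ξ (x', τ', y'))) +
        τ * τ' * (τ' * ⟪y, (A x' + (1 / τ') • z₀) - (A x + (1 / τ) • z₀)⟫_ℝ +
          τ * ⟪y', (A x + (1 / τ) • z₀) - (A x' + (1 / τ') • z₀)⟫_ℝ) := by
  simp only [mu, yτ₀, mul_add, ← mul_assoc, inner_sub_right, inner_map_add_smul hy,
    inner_map_add_smul hy']
  have hξ0 : ξ ≠ 0 := left_ne_zero_of_mul hξϑ
  have hϑ0 : ϑ ≠ 0 := right_ne_zero_of_mul hξϑ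
  field_simp
  ring

theorem mu_mul_sq_add_mu_mul_sq_le (hϑ : 0 < ϑ) (hξ : 0 < ξ) (hκ : 0 < ξ - 1 - κ) {x x' : X}
    {τ τ' : ℝ} {y y' : E} (hτ : 0 < τ) (hτ' : 0 < τ')
    (hy : A.adjoint y - A.adjoint (gradient Φ z₀) = -((τ - 1) • c))
    (hy' : A.adjoint y' - A.adjoint (gradient Φ z₀) = -((τ' - 1) • c))
    (hb : τ * ⟪y, (A x' + (1 / τ') • z₀) - (A x + (1 / τ) • z₀)⟫_ℝ ≤
      mu A c Φ z₀ ϑ ξ (x, τ, y) * ((1 + κ) * ϑ))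
    (hb' : τ' * ⟪y', (A x + (1 / τ) • z₀) - (A x' + (1 / τ') • z₀)⟫_ℝ ≤
      mu A c Φ z₀ ϑ ξ (x', τ', y') * ((1 + κ) * ϑ)) :
    mu A c Φ z₀ ϑ ξ (x, τ, y) * τ' ^ 2 + mu A c Φ z₀ ϑ ξ (x', τ', y') * τ ^ 2 ≤
      ξ / (ξ - 1 - κ) * (τ * τ' *
        (mu A c Φ z₀ ϑ ξ (x, τ, y) + mu A c Φ z₀ ϑ ξ (x', τ', y'))) := by
  have hid := mu_mul_sq_add_mu_mul_sq (mul_pos hξ hϑ).ne' (x := x) (x' := x') hτ hτ' hy hy'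
  have h1 := mul_le_mul_of_nonneg_left hb (sq_nonneg τ')
  have h2 := mul_le_mul_of_nonneg_left hb' (sq_nonneg τ)
  rw [div_mul_eq_mul_div, le_div_iff₀ hκ]
  refine le_of_mul_le_mul_left ?_ hϑ
  linarith

/-- Closeness to the central path controls the cross terms `⟨y, z' - z⟩`. -/
theorem IsClose.mul_inner_le {x : X} {τ : ℝ} {y z' : E} (hΦ : IsSelfConcordantBarrier ϑ U Φ)
    (hp : IsClose A c U Φ z₀ ϑ ξ κ (x, τ, y)) (hz' : z' ∈ U) :
    τ * ⟪y, z' - (A x + (1 / τ) • z₀)⟫_ℝ ≤ mu A c Φ z₀ ϑ ξ (x, τ, y) * ((1 + κ) * ϑ) := by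
  obtain ⟨⟨-, hτ, -, hyD⟩, hμ, hnorm⟩ := hp
  have h1 := hΦ.inner_sub_le_of_inverseNorm_le
    (smul_mem_interior_dualCone hyD (div_pos hτ hμ)) hz' hnorm
  rw [inner_smul_left, conj_trivial, div_mul_eq_mul_div, div_le_iff₀ hμ] at h1
  linarith

end CentralPath

end DomainDriven

theorem mainTheorem9
    {X E : Type*} [NormedAddCommGroup X] [InnerProductSpace ℝ X] [FiniteDimensional ℝ X]
    [NormedAddCommGroup E] [InnerProductSpace ℝ E] [FiniteDimensional ℝ E]
    (A : X →ₗ[ℝ] E) (c : X) (ϑ : ℝ) (U : Set E) (Φ : E → ℝ)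
    (hΦ : DomainDriven.IsSelfConcordantBarrier ϑ U Φ)
    (z₀ : E) (hz₀ : z₀ ∈ interior (closure U))
    (ξ κ : ℝ) (hξ : 1 < ξ) (hκ : 0 < ξ - 1 - κ) :
    (∀ (x x' : X) (τ τ' : ℝ) (y y' : E),
      DomainDriven.IsClose A c U Φ z₀ ϑ ξ κ (x, τ, y) →
      DomainDriven.IsClose A c U Φ z₀ ϑ ξ κ (x', τ', y') →
      DomainDriven.mu A c Φ z₀ ϑ ξ (x, τ, y) * τ' ^ 2
          + DomainDriven.mu A c Φ z₀ ϑ ξ (x', τ', y') * τ ^ 2 ≤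
        ξ / (ξ - 1 - κ) * (τ * τ' *
          (DomainDriven.mu A c Φ z₀ ϑ ξ (x, τ, y) +
            DomainDriven.mu A c Φ z₀ ϑ ξ (x', τ', y')))) ∧
    (∀ (x : X) (τ : ℝ) (y : E),
      DomainDriven.IsClose A c U Φ z₀ ϑ ξ κ (x, τ, y) →
      1 ≤ DomainDriven.mu A c Φ z₀ ϑ ξ (x, τ, y) →
      (ξ - 1 - κ) / (2 * ξ) ≤ τ) := by
  have hU := hΦ.interior_closure hz₀
  have hϑ := hΦ.pos
  have hξ0 : 0 < ξ := one_pos.trans hξ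
  refine ⟨fun x x' τ τ' y y' hp hp' => ?_, fun x τ y hp hμ => ?_⟩
  · exact DomainDriven.mu_mul_sq_add_mu_mul_sq_le hϑ hξ0 hκ hp.1.2.1 hp'.1.2.1 hp.1.2.2.1
      hp'.1.2.2.1 (hp.mul_inner_le hΦ (hU ▸ hp'.1.1)) (hp'.mul_inner_le hΦ (hU ▸ hp.1.1))
  · -- Compare with the starting point `(0, 1, Φ'(z₀))`, where `μ = 1` and `z = v = z₀`.
    have hκ0 : 0 ≤ κ := (Real.sqrt_nonneg _).trans hp.2.2
    have hτ : 0 < τ := hp.1.2.1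
    have hzU : A x + (1 / τ) • z₀ ∈ U := hU ▸ hp.1.1
    rw [hU] at hz₀
    have hz : A (0 : X) + (1 / (1 : ℝ)) • z₀ = z₀ := by simp
    have hμ1 : DomainDriven.mu A c Φ z₀ ϑ ξ (0, 1, gradient Φ z₀) = 1 := by
      simp only [DomainDriven.mu, DomainDriven.yτ₀, hz, inner_zero_right]
      field_simp
      ring
    have h1 := hΦ.dirDeriv_one_sub_le hz₀ hzU
    rw [DomainDriven.dirDeriv_one_eq_inner (hΦ.differentiableAt hz₀)] at h1
    have h2 := DomainDriven.mu_mul_sq_add_mu_mul_sq_le hϑ hξ0 hκ (x := x) (x' := (0 : X)) hτ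
      one_pos hp.1.2.2.1 (y' := gradient Φ z₀) (by simp)
      (hp.mul_inner_le hΦ (by rwa [hz])) (by
        rw [hμ1, hz]
        nlinarith)
    rw [hμ1] at h2
    set μ := DomainDriven.mu A c Φ z₀ ϑ ξ (x, τ, y)
    rw [div_mul_eq_mul_div, le_div_iff₀ hκ] at h2
    rw [div_le_iff₀ (by positivity)]
    refine le_of_mul_le_mul_left ?_ (one_pos.trans_le hμ)
    have h3 : ξ * τ * 1 ≤ ξ * τ * μ := mul_le_mul_of_nonneg_left hμ (by positivity)
    have h4 : 0 ≤ τ ^ 2 * (ξ - 1 - κ) := by positivity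
    nlinarith
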